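/- Let $N\ge 0$ be an integer and let $\mathbb{R}^N$ carry the Euclidean norm; $B_\varepsilon$ denotes the ball of radius $\varepsilon$ about the origin. Let $\mathscr{D}_o$ be the set of smooth, compactly supported $\varphi:\mathbb{R}^N\to\mathbb{R}$ with $\varphi\ge 0$ and $\int\varphi=1$, and put $s(\varphi)=\inf\{\varepsilon>0:\operatorname{supp}\varphi\subseteq B_\varepsilon\}$. A delta sequence is a sequence $(\delta_m)$ in $\mathscr{D}_o$ with $s(\delta_m)\to 0$. For $U\subseteq\mathbb{R}^N$ open, let $\mathscr{C}(U)$ be the space of continuous functions $U\to\mathbb{R}$. For $f\in\mathscr{C}(U)$ and $\varphi\in\mathscr{D}_o$, the convolution $(f*\varphi)(x)=\int f(y)\varphi(x-y)\,dy$ is defined at every $x$ with $x-\operatorname{supp}\varphi\subseteq U$ (the integrand being $0$ where $\varphi(x-y)=0$). A sequence $(f_n)$ in $\mathscr{C}(U)$ is fundamental if for every compact $K\subseteq U$ there is a delta sequence $(\delta_m)$ such that, for every $m$, the functions $f_n*\delta_m$ are defined on $K$ and converge uniformly on $K$ as $n\to\infty$. For fundamental sequences write $(f_n)\sim(g_n)$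 if for every compact $K\subseteq U$ there is a delta sequence $(\delta_m)$ such that, for every $m$, the functions $(f_n-g_n)*\delta_m$ are defined on $K$ and converge uniformly to $0$ on $K$ as $n\to\infty$. This is an equivalence relation, and the set $\mathfrak{B}(U)$ of its classes, the space of Boehmians on $U$, is a real vector space under termwise operations. For open $V\subseteq U$ the restriction map $\mathfrak{B}(U)\to\mathfrak{B}(V)$, $F\mapsto F|_V$, sends $[(f_n)]$ to $[(f_n|_V)]$; it is well defined and linear, and these maps make $U\mapsto\mathfrak{B}(U)$ a presheaf of real vector spaces on $\mathbb{R}^N$. Theorem. The presheaf $U\mapsto\mathfrak{B}(U)$ is a sheaf on $\mathbb{R}^N$. Explicitly, for every family $(U_\alpha)$ of open subsets of $\mathbb{R}^N$ (with arbitrary index set) and $U=\bigcup_\alpha U_\alpha$: (a) (Locality) if $F,G\in\mathfrak{B}(U)$ satisfy $F|_{U_\alpha}=G|_{U_\alpha}$ for every $\alpha$, then $F=G$; (b) (Gluing) if $F_\alpha\in\mathfrak{B}(U_\alpha)$ satisfy $F_\alpha|_{U_\alpha\cap U_\beta}=F_\beta|_{U_\alpha\cap U_\beta}$ for all $\alpha,\beta$,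 then there is $F\in\mathfrak{B}(U)$ with $F|_{U_\alpha}=F_\alpha$ for every $\alpha$. -/

import Mathlib

namespace Boehmians

open MeasureTheory TopologicalSpace Set Filter Metric CategoryTheory Opposite
open scoped Topology ContDiff Convolution Pointwise

/-- Euclidean space of dimension `N`. -/
abbrev E (N : ℕ) : Type := EuclideanSpace ℝ (Fin N)

variable {N : ℕ}

/-- Nonnegative test functions (smooth, compactly supported) of integral one. -/
structure IsUnitTest (φ : E N → ℝ) : Prop where
  smooth : ContDiff ℝ ∞ φ
  compact : HasCompactSupport φ
  nonneg : ∀ x, 0 ≤ φ x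
  integral_eq_one : ∫ x, φ x = 1

/-- The radius `s(φ)` of the support: the infimum of the `ε > 0` with `supp φ ⊆ B_ε(0)`. -/
noncomputable def size (φ : E N → ℝ) : ℝ :=
  sInf {ε : ℝ | 0 < ε ∧ tsupport φ ⊆ ball 0 ε}

/-- Delta sequences. -/
structure IsDelta (φ : ℕ → E N → ℝ) : Prop where
  test : ∀ n, IsUnitTest (φ n)
  size_tendsto : Tendsto (fun n => size (φ n)) atTop (𝓝 0)

/-- Extension of a function on `U` by zero; only its values on `U` ever matter, see `conv`. -/
noncomputable def zeroExtend {U : Opens (E N)} (f : C(U, ℝ)) : E N → ℝ :=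
  Function.extend Subtype.val f 0

/-- The convolution `(f ∗ φ)(x) = ∫ f(y) φ(x - y) dy` of a continuous function on `U` with a test
function. The integrand is zero wherever `φ (x - y) = 0`, even where `f` is not defined; the value
is meaningful for those `x` with `x - supp φ ⊆ U`, see `ConvDefinedOn`. -/
noncomputable def conv {U : Opens (E N)} (f : C(U, ℝ)) (φ : E N → ℝ) : E N → ℝ :=
  (zeroExtend f) ⋆[ContinuousLinearMap.mul ℝ ℝ, volume] φ

/-- Convolutions with `φ` of functions on `U` are defined at all points of `K`. -/
def ConvDefinedOn (U : Set (E N)) (φ : E N → ℝ) (K : Set (E N)) : Prop :=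
  ∀ x ∈ K, ∀ y ∈ tsupport φ, x - y ∈ U

/-- Fundamental sequences of continuous functions on `U`. -/
def IsFundamental {U : Opens (E N)} (f : ℕ → C(U, ℝ)) : Prop :=
  ∀ K : Set (E N), IsCompact K → K ⊆ U → ∃ δ : ℕ → E N → ℝ, IsDelta δ ∧
    ∀ m, ConvDefinedOn U (δ m) K ∧
      ∃ g : E N → ℝ, TendstoUniformlyOn (fun n => conv (f n) (δ m)) g atTop K

/-- The relation `(h_n) ∼ (0)`: over every compact set there is a delta sequence `(δ_m)` such that
`h_n ∗ δ_m → 0` uniformly as `n → ∞`, for each `m`. -/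
def IsNull {U : Opens (E N)} (h : ℕ → C(U, ℝ)) : Prop :=
  ∀ K : Set (E N), IsCompact K → K ⊆ U → ∃ δ : ℕ → E N → ℝ, IsDelta δ ∧
    ∀ m, ConvDefinedOn U (δ m) K ∧
      TendstoUniformlyOn (fun n => conv (h n) (δ m)) 0 atTop K

/-! ### Elementary facts on delta sequences and local convolutions -/

theorem size_nonneg (φ : E N → ℝ) : 0 ≤ size φ :=
  Real.sInf_nonneg fun _ h => h.1.le

theorem size_le {φ : E N → ℝ} {ε : ℝ} (hε : 0 < ε) (h : tsupport φ ⊆ ball 0 ε) : size φ ≤ ε :=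
  csInf_le ⟨0, fun _ h => h.1.le⟩ ⟨hε, h⟩

theorem tsupport_subset_of_size_lt {φ : E N → ℝ} (hφ : HasCompactSupport φ) {ε : ℝ}
    (h : size φ < ε) : tsupport φ ⊆ ball 0 ε := by
  have hne : {ε : ℝ | 0 < ε ∧ tsupport φ ⊆ ball (0 : E N) ε}.Nonempty := by
    obtain ⟨r, hr⟩ := hφ.isCompact.isBounded.subset_ball (0 : E N)
    exact ⟨max r 1, by positivity, hr.trans (ball_subset_ball (le_max_left _ _))⟩
  obtain ⟨r, ⟨_, hr⟩, hrε⟩ := exists_lt_of_csInf_lt hne h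
  exact hr.trans (ball_subset_ball hrε.le)

theorem IsDelta.eventually {δ : ℕ → E N → ℝ} (hδ : IsDelta δ) {ε : ℝ} (hε : 0 < ε) :
    ∀ᶠ n in atTop, tsupport (δ n) ⊆ ball 0 ε :=
  (hδ.size_tendsto.eventually_lt_const hε).mono fun n hn =>
    tsupport_subset_of_size_lt (hδ.test n).compact hn

theorem isDelta_of {δ : ℕ → E N → ℝ} (h : ∀ n, IsUnitTest (δ n))
    (h' : ∀ ε > 0, ∀ᶠ n in atTop, tsupport (δ n) ⊆ ball 0 ε) : IsDelta δ := by
  refine ⟨h, ?_⟩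
  rw [Metric.tendsto_nhds]
  intro ε hε
  filter_upwards [h' (ε / 2) (by positivity)] with n hn
  have h1 := size_le (by positivity) hn
  have h2 := size_nonneg (δ n)
  rw [Real.dist_eq, sub_zero, abs_of_nonneg h2]
  linarith

theorem IsDelta.shift {δ : ℕ → E N → ℝ} (hδ : IsDelta δ) (M : ℕ) :
    IsDelta (fun n => δ (n + M)) :=
  ⟨fun n => hδ.test _, (tendsto_add_atTop_iff_nat M).2 hδ.size_tendsto⟩

theorem exists_isDelta (N : ℕ) : ∃ δ : ℕ → E N → ℝ, IsDelta δ := by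
  let b : ℕ → ContDiffBump (0 : E N) := fun n =>
    ⟨1 / (2 * (n + 1)), 1 / (n + 1), by positivity, by
      rw [div_lt_div_iff_of_pos_left] <;> first | positivity | skip
      have : (0 : ℝ) ≤ n := n.cast_nonneg
      linarith⟩
  refine ⟨fun n => (b n).normed volume, isDelta_of (fun n => ?_) fun ε hε => ?_⟩
  · exact ⟨(b n).contDiff_normed, (b n).hasCompactSupport_normed, (b n).nonneg_normed,
      (b n).integral_normed⟩
  · have h := (tendsto_one_div_add_atTop_nhds_zero_nat (𝕜 := ℝ)).eventually_lt_const hε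
    filter_upwards [h] with n hn
    rw [(b n).tsupport_normed_eq]
    exact closedBall_subset_ball hn

theorem IsUnitTest.continuous {φ : E N → ℝ} (hφ : IsUnitTest φ) : Continuous φ :=
  hφ.smooth.continuous

theorem IsUnitTest.integrable {φ : E N → ℝ} (hφ : IsUnitTest φ) : Integrable φ :=
  hφ.continuous.integrable_of_hasCompactSupport hφ.compact

theorem tsupport_conv_subset {φ ψ : E N → ℝ} (hφ : IsUnitTest φ) (hψ : IsUnitTest ψ) :
    tsupport (φ ⋆[ContinuousLinearMap.mul ℝ ℝ, volume] ψ) ⊆ tsupport φ + tsupport ψ :=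
  closure_minimal ((support_convolution_subset _).trans
    (add_subset_add (subset_tsupport _) (subset_tsupport _)))
    (hφ.compact.isCompact.add hψ.compact.isCompact).isClosed

theorem IsUnitTest.convolution {φ ψ : E N → ℝ} (hφ : IsUnitTest φ) (hψ : IsUnitTest ψ) :
    IsUnitTest (φ ⋆[ContinuousLinearMap.mul ℝ ℝ, volume] ψ) where
  smooth := hψ.compact.contDiff_convolution_right _ hφ.continuous.locallyIntegrable hψ.smooth
  compact := HasCompactSupport.convolution _ hφ.compact hψ.compact
  nonneg x := by
    rw [convolution_def]
    exact integral_nonneg fun t => mul_nonneg (hφ.nonneg _) (hψ.nonneg _)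
  integral_eq_one := by
    rw [integral_convolution _ hφ.integrable hψ.integrable, hφ.integral_eq_one,
      hψ.integral_eq_one]
    simp

theorem IsDelta.convolution {φ ψ : ℕ → E N → ℝ} (hφ : IsDelta φ) (hψ : IsDelta ψ) :
    IsDelta (fun n => φ n ⋆[ContinuousLinearMap.mul ℝ ℝ, volume] ψ n) := by
  refine isDelta_of (fun n => (hφ.test n).convolution (hψ.test n)) fun ε hε => ?_
  filter_upwards [hφ.eventually (half_pos hε), hψ.eventually (half_pos hε)] with n h1 h2
  intro x hx
  obtain ⟨a, ha, b, hb, rfl⟩ := tsupport_conv_subset (hφ.test n) (hψ.test n) hx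
  have ha := h1 ha
  have hb := h2 hb
  rw [mem_ball_zero_iff] at *
  linarith [norm_add_le a b]

theorem zeroExtend_apply {U : Opens (E N)} (f : C(U, ℝ)) {x : E N} (hx : x ∈ U) :
    zeroExtend f x = f ⟨x, hx⟩ :=
  Subtype.val_injective.extend_apply f 0 ⟨x, hx⟩

theorem continuousOn_zeroExtend {U : Opens (E N)} (f : C(U, ℝ)) :
    ContinuousOn (zeroExtend f) U := by
  rw [continuousOn_iff_continuous_domRestrict]
  exact f.continuous.congr fun x => (zeroExtend_apply f x.2).symm

/-- Under the standing support condition, the extension may be cut off to any compact set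
containing `x - supp φ`. -/
theorem conv_eq_cutoff {U : Opens (E N)} (f : C(U, ℝ)) (φ : E N → ℝ) (x : E N) (C : Set (E N))
    (h : ∀ y ∈ tsupport φ, x - y ∈ C) :
    conv f φ x =
      ((C.indicator (zeroExtend f)) ⋆[ContinuousLinearMap.mul ℝ ℝ, volume] φ) x := by
  rw [conv, convolution_def, convolution_def]
  congr 1
  ext t
  by_cases ht : t ∈ C
  · rw [indicator_of_mem ht]
  · have : φ (x - t) = 0 := by
      by_contra h0
      exact ht (by simpa using h _ (subset_tsupport _ h0))
    simp [this]

theorem integrable_cutoff {U : Opens (E N)} (f : C(U, ℝ)) {C : Set (E N)} (hC : IsCompact C)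
    (hCU : C ⊆ U) : Integrable (C.indicator (zeroExtend f)) :=
  (((continuousOn_zeroExtend f).mono hCU).integrableOn_compact hC).integrable_indicator
    hC.measurableSet

theorem convolutionExistsAt {U : Opens (E N)} (f : C(U, ℝ)) {φ : E N → ℝ} (hφ : IsUnitTest φ)
    {x : E N} (h : ∀ y ∈ tsupport φ, x - y ∈ U) :
    ConvolutionExistsAt (zeroExtend f) φ x (ContinuousLinearMap.mul ℝ ℝ) volume := by
  let C : Set (E N) := (fun y => x - y) '' tsupport φ
  have hC : IsCompact C := hφ.compact.isCompact.image (by fun_prop)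
  have hCU : C ⊆ U := by rintro _ ⟨y, hy, rfl⟩; exact h y hy
  have h1 := (hφ.compact.convolutionExists_right (ContinuousLinearMap.mul ℝ ℝ)
    (integrable_cutoff f hC hCU).locallyIntegrable hφ.continuous) x
  refine h1.congr (Eventually.of_forall fun t => ?_)
  by_cases ht : t ∈ C
  · simp [indicator_of_mem ht]
  · have : φ (x - t) = 0 := by
      by_contra h0
      exact ht ⟨x - t, subset_tsupport _ h0, by simp⟩
    simp [this]

theorem conv_add {U : Opens (E N)} (f g : C(U, ℝ)) {φ : E N → ℝ} (hφ : IsUnitTest φ)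
    {x : E N} (h : ∀ y ∈ tsupport φ, x - y ∈ U) :
    conv (f + g) φ x = conv f φ x + conv g φ x := by
  have e : zeroExtend (f + g) = zeroExtend f + zeroExtend g := by
    ext y
    by_cases hy : y ∈ U
    · simp [zeroExtend_apply _ hy]
    · simp [zeroExtend, hy]
  rw [conv, e]
  exact (convolutionExistsAt f hφ h).add_distrib (convolutionExistsAt g hφ h)

theorem conv_smul {U : Opens (E N)} (c : ℝ) (f : C(U, ℝ)) (φ : E N → ℝ) :
    conv (c • f) φ = c • conv f φ := by
  have e : zeroExtend (c • f) = c • zeroExtend f := by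
    ext y
    by_cases hy : y ∈ U
    · simp [zeroExtend_apply _ hy]
    · simp [zeroExtend, hy]
  rw [conv, e, smul_convolution]
  rfl

theorem conv_zero {U : Opens (E N)} (φ : E N → ℝ) : conv (0 : C(U, ℝ)) φ = 0 := by
  simpa using conv_smul 0 (0 : C(U, ℝ)) φ

theorem conv_sub {U : Opens (E N)} (f g : C(U, ℝ)) {φ : E N → ℝ} (hφ : IsUnitTest φ)
    {x : E N} (h : ∀ y ∈ tsupport φ, x - y ∈ U) :
    conv (f - g) φ x = conv f φ x - conv g φ x := by
  have := conv_add (f - g) g hφ h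
  rw [sub_add_cancel] at this
  linarith

/-- Convolving once more with a unit test function does not increase uniform bounds. -/
theorem abs_conv_convolution_le {U : Opens (E N)} (f : C(U, ℝ)) {φ ψ : E N → ℝ}
    (hφ : IsUnitTest φ) (hψ : IsUnitTest ψ) {K K' : Set (E N)} (hK' : ConvDefinedOn U φ K')
    (hK : ConvDefinedOn K' ψ K) {c : ℝ} (hc : ∀ z ∈ K', |conv f φ z| ≤ c) :
    ∀ x ∈ K, |conv f (φ ⋆[ContinuousLinearMap.mul ℝ ℝ, volume] ψ) x| ≤ c := by
  intro x hx
  let C : Set (E N) := (fun y => x - y) '' (tsupport φ + tsupport ψ)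
  have hC : IsCompact C :=
    (hφ.compact.isCompact.add hψ.compact.isCompact).image (by fun_prop)
  have hCU : C ⊆ U := by
    rintro _ ⟨_, ⟨a, ha, b, hb, rfl⟩, rfl⟩
    have := hK' _ (hK x hx b hb) a ha
    rwa [sub_sub, add_comm] at this
  set F := C.indicator (zeroExtend f) with hF
  have hFi : Integrable F := integrable_cutoff f hC hCU
  have e1 : conv f (φ ⋆[ContinuousLinearMap.mul ℝ ℝ, volume] ψ) x =
      (F ⋆[ContinuousLinearMap.mul ℝ ℝ, volume]
        (φ ⋆[ContinuousLinearMap.mul ℝ ℝ, volume] ψ)) x :=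
    conv_eq_cutoff f _ x C fun y hy => ⟨y, tsupport_conv_subset hφ hψ hy, rfl⟩
  have e2 : ((F ⋆[ContinuousLinearMap.mul ℝ ℝ, volume] φ)
        ⋆[ContinuousLinearMap.mul ℝ ℝ, volume] ψ) x =
      (F ⋆[ContinuousLinearMap.mul ℝ ℝ, volume]
        (φ ⋆[ContinuousLinearMap.mul ℝ ℝ, volume] ψ)) x := by
    have hnn : ∀ χ : E N → ℝ, IsUnitTest χ → (fun x => ‖χ x‖) = χ := fun χ hχ =>
      funext fun x => by rw [Real.norm_eq_abs, abs_of_nonneg (hχ.nonneg x)]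
    refine convolution_assoc _ _ _ _ (fun a b c => mul_assoc a b c)
      hFi.aestronglyMeasurable hφ.continuous.aestronglyMeasurable
      hψ.continuous.aestronglyMeasurable
      (Eventually.of_forall (hφ.compact.convolutionExists_right _ hFi.locallyIntegrable
        hφ.continuous)) ?_ ?_
    · rw [hnn φ hφ, hnn ψ hψ]
      exact Eventually.of_forall (hψ.compact.convolutionExists_right _
        hφ.continuous.locallyIntegrable hψ.continuous)
    · rw [hnn φ hφ, hnn ψ hψ]
      exact (hφ.convolution hψ).compact.convolutionExists_right _
        hFi.norm.locallyIntegrable (hφ.convolution hψ).continuous x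
  rw [e1, ← e2, convolution_eq_swap, ← Real.norm_eq_abs]
  have hb : ∀ t, ‖ContinuousLinearMap.mul ℝ ℝ
      ((F ⋆[ContinuousLinearMap.mul ℝ ℝ, volume] φ) (x - t)) (ψ t)‖ ≤ c * ψ t := by
    intro t
    rw [ContinuousLinearMap.mul_apply', norm_mul, Real.norm_eq_abs, Real.norm_eq_abs,
      abs_of_nonneg (hψ.nonneg t)]
    by_cases ht : t ∈ tsupport ψ
    · refine mul_le_mul_of_nonneg_right ?_ (hψ.nonneg t)
      rw [← conv_eq_cutoff f φ (x - t) C fun y hy =>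
        ⟨y + t, add_mem_add hy ht, by simp only; abel⟩]
      exact hc _ (hK x hx t ht)
    · simp [image_eq_zero_of_notMem_tsupport ht]
  refine (norm_integral_le_of_norm_le (hψ.integrable.const_mul c)
    (Eventually.of_forall hb)).trans ?_
  rw [integral_const_mul, hψ.integral_eq_one, mul_one]

/-- Two delta sequences adapted to a neighbourhood `K'` of `K` have a common refinement. -/
theorem exists_common {U : Opens (E N)} {K K' : Set (E N)} {ε : ℝ} (hε : 0 < ε)
    (hK' : cthickening ε K ⊆ K') {δ η : ℕ → E N → ℝ} (hδ : IsDelta δ) (hη : IsDelta η)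
    (hδK : ∀ m, ConvDefinedOn U (δ m) K') (hηK : ∀ m, ConvDefinedOn U (η m) K') :
    ∃ ξ : ℕ → E N → ℝ, IsDelta ξ ∧ ∀ m, ConvDefinedOn U (ξ m) K ∧ ∃ i, ∀ (f : C(U, ℝ)) (c : ℝ),
      ((∀ z ∈ K', |conv f (δ i) z| ≤ c) ∨ (∀ z ∈ K', |conv f (η i) z| ≤ c)) →
        ∀ x ∈ K, |conv f (ξ m) x| ≤ c := by
  obtain ⟨M, hM⟩ := eventually_atTop.1 ((hδ.eventually hε).and (hη.eventually hε))
  have key : ∀ χ : E N → ℝ, tsupport χ ⊆ ball 0 ε → ConvDefinedOn K' χ K := by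
    intro χ hχ x hx y hy
    refine hK' (mem_cthickening_of_dist_le _ x _ _ hx ?_)
    have := hχ hy
    rw [mem_ball_zero_iff] at this
    rw [dist_eq_norm, sub_sub_cancel_left, norm_neg]
    exact this.le
  refine ⟨_, (hδ.shift M).convolution (hη.shift M), fun m => ⟨?_, m + M, fun f c h => ?_⟩⟩
  · intro x hx y hy
    obtain ⟨a, ha, b, hb, rfl⟩ := tsupport_conv_subset (hδ.test _) (hη.test _) hy
    have := hδK _ _ (key _ (hM _ (Nat.le_add_left M m)).2 x hx b hb) a ha
    rwa [sub_sub, add_comm] at this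
  · rcases h with h | h
    · exact abs_conv_convolution_le f (hδ.test _) (hη.test _) (hδK _)
        (key _ (hM _ (Nat.le_add_left M m)).2) h
    · have hcomm : (δ (m + M) ⋆[ContinuousLinearMap.mul ℝ ℝ, volume] η (m + M)) =
          (η (m + M) ⋆[ContinuousLinearMap.mul ℝ ℝ, volume] δ (m + M)) := by
        rw [← convolution_flip]
        congr 1
        ext
        simp
      simp only [hcomm]
      exact abs_conv_convolution_le f (hη.test _) (hδ.test _) (hηK _)
        (key _ (hM _ (Nat.le_add_left M m)).1) h

theorem exists_thickening {U : Opens (E N)} {K : Set (E N)} (hK : IsCompact K) (hKU : K ⊆ U) :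
    ∃ ε : ℝ, 0 < ε ∧ IsCompact (cthickening ε K) ∧ cthickening ε K ⊆ U := by
  obtain ⟨ε, hε, h⟩ := hK.exists_cthickening_subset_open U.isOpen hKU
  exact ⟨ε, hε, hK.cthickening, h⟩

/-- Delta sequences may be shifted so that all convolutions are defined on a given compact set. -/
theorem IsDelta.exists_convDefinedOn {δ : ℕ → E N → ℝ} (hδ : IsDelta δ) {U : Opens (E N)}
    {K : Set (E N)} (hK : IsCompact K) (hKU : K ⊆ U) :
    ∃ M, ∀ m, ConvDefinedOn U (δ (m + M)) K := by
  obtain ⟨ε, hε, -, hεU⟩ := exists_thickening hK hKU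
  obtain ⟨M, hM⟩ := eventually_atTop.1 (hδ.eventually hε)
  refine ⟨M, fun m x hx y hy => hεU (mem_cthickening_of_dist_le _ x _ _ hx ?_)⟩
  have := hM _ (Nat.le_add_left M m) hy
  rw [mem_ball_zero_iff] at this
  rw [dist_eq_norm, sub_sub_cancel_left, norm_neg]
  exact this.le

theorem IsNull.add {U : Opens (E N)} {f g : ℕ → C(U, ℝ)} (hf : IsNull f) (hg : IsNull g) :
    IsNull (f + g) := by
  intro K hK hKU
  obtain ⟨ε, hε, hK', hK'U⟩ := exists_thickening hK hKU
  obtain ⟨δ, hδ, hfδ⟩ := hf _ hK' hK'U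
  obtain ⟨η, hη, hgη⟩ := hg _ hK' hK'U
  obtain ⟨ξ, hξ, h⟩ := exists_common hε subset_rfl hδ hη (fun m => (hfδ m).1) (fun m => (hgη m).1)
  refine ⟨ξ, hξ, fun m => ⟨(h m).1, ?_⟩⟩
  obtain ⟨hd, i, hi⟩ := h m
  rw [Metric.tendstoUniformlyOn_iff]
  intro c hc
  have h1 := Metric.tendstoUniformlyOn_iff.1 (hfδ i).2 (c / 3) (by positivity)
  have h2 := Metric.tendstoUniformlyOn_iff.1 (hgη i).2 (c / 3) (by positivity)
  filter_upwards [h1, h2] with n h1 h2 x hx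
  have b1 := hi (f n) (c / 3) (Or.inl fun z hz => by simpa using (h1 z hz).le) x hx
  have b2 := hi (g n) (c / 3) (Or.inr fun z hz => by simpa using (h2 z hz).le) x hx
  rw [Pi.zero_apply, dist_zero_left, Pi.add_apply, conv_add _ _ (hξ.test m) (hd x hx),
    Real.norm_eq_abs]
  have := abs_add_le (conv (f n) (ξ m) x) (conv (g n) (ξ m) x)
  linarith

theorem IsFundamental.add {U : Opens (E N)} {f g : ℕ → C(U, ℝ)} (hf : IsFundamental f)
    (hg : IsFundamental g) : IsFundamental (f + g) := by
  intro K hK hKU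
  obtain ⟨ε, hε, hK', hK'U⟩ := exists_thickening hK hKU
  obtain ⟨δ, hδ, hfδ⟩ := hf _ hK' hK'U
  obtain ⟨η, hη, hgη⟩ := hg _ hK' hK'U
  obtain ⟨ξ, hξ, h⟩ := exists_common hε subset_rfl hδ hη (fun m => (hfδ m).1) (fun m => (hgη m).1)
  refine ⟨ξ, hξ, fun m => ⟨(h m).1, ?_⟩⟩
  obtain ⟨hd, i, hi⟩ := h m
  obtain ⟨-, F, hF⟩ := hfδ i
  obtain ⟨-, G, hG⟩ := hgη i
  have hC : UniformCauchySeqOn (fun n => conv ((f + g) n) (ξ m)) atTop K := by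
    rw [Metric.uniformCauchySeqOn_iff]
    intro c hc
    obtain ⟨n1, h1⟩ := Metric.uniformCauchySeqOn_iff.1 hF.uniformCauchySeqOn (c / 3)
      (by positivity)
    obtain ⟨n2, h2⟩ := Metric.uniformCauchySeqOn_iff.1 hG.uniformCauchySeqOn (c / 3)
      (by positivity)
    refine ⟨max n1 n2, fun p hp q hq x hx => ?_⟩
    have b1 := hi (f p - f q) (c / 3) (Or.inl fun z hz => by
      rw [conv_sub _ _ (hδ.test i) ((hfδ i).1 z hz), ← Real.dist_eq]
      exact (h1 p (le_of_max_le_left hp) q (le_of_max_le_left hq) z hz).le) x hx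
    have b2 := hi (g p - g q) (c / 3) (Or.inr fun z hz => by
      rw [conv_sub _ _ (hη.test i) ((hgη i).1 z hz), ← Real.dist_eq]
      exact (h2 p (le_of_max_le_right hp) q (le_of_max_le_right hq) z hz).le) x hx
    rw [Real.dist_eq, ← conv_sub _ _ (hξ.test m) (hd x hx), Pi.add_apply, Pi.add_apply,
      add_sub_add_comm, conv_add _ _ (hξ.test m) (hd x hx)]
    have := abs_add_le (conv (f p - f q) (ξ m) x) (conv (g p - g q) (ξ m) x)
    linarith
  have hlim : ∀ x, ∃ y, x ∈ K →
      Tendsto (fun n => conv ((f + g) n) (ξ m) x) atTop (𝓝 y) := by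
    intro x
    by_cases hx : x ∈ K
    · obtain ⟨y, hy⟩ := cauchySeq_tendsto_of_complete (hC.cauchySeq hx)
      exact ⟨y, fun _ => hy⟩
    · exact ⟨0, fun h => absurd h hx⟩
  choose L hL using hlim
  exact ⟨L, hC.tendstoUniformlyOn_of_tendsto fun x hx => hL x hx⟩

theorem isNull_zero (U : Opens (E N)) : IsNull (0 : ℕ → C(U, ℝ)) := by
  intro K hK hKU
  obtain ⟨δ, hδ⟩ := exists_isDelta N
  obtain ⟨M, hM⟩ := hδ.exists_convDefinedOn hK hKU
  refine ⟨_, hδ.shift M, fun m => ⟨hM m, ?_⟩⟩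
  simp only [Pi.zero_apply, conv_zero]
  exact Metric.tendstoUniformlyOn_iff.2 fun ε hε => by simp [hε]

theorem IsNull.isFundamental {U : Opens (E N)} {f : ℕ → C(U, ℝ)} (hf : IsNull f) :
    IsFundamental f := fun K hK hKU =>
  let ⟨δ, hδ, h⟩ := hf K hK hKU
  ⟨δ, hδ, fun m => ⟨(h m).1, 0, (h m).2⟩⟩

theorem tendstoUniformlyOn_conv_smul {U : Opens (E N)} {f : ℕ → C(U, ℝ)} {φ g : E N → ℝ}
    {K : Set (E N)} (c : ℝ) (h : TendstoUniformlyOn (fun n => conv (f n) φ) g atTop K) :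
    TendstoUniformlyOn (fun n => conv ((c • f) n) φ) (c • g) atTop K := by
  simp only [Pi.smul_apply, conv_smul]
  exact (uniformContinuous_const_smul c).comp_tendstoUniformlyOn h

/-! ### The space of Boehmians on an open set -/

/-- The real vector space of fundamental sequences on `U`. -/
def fundamental (U : Opens (E N)) : Submodule ℝ (ℕ → C(U, ℝ)) where
  carrier := {f | IsFundamental f}
  add_mem' := IsFundamental.add
  zero_mem' := (isNull_zero U).isFundamental
  smul_mem' c _ hf := fun K hK hKU =>
    let ⟨δ, hδ, h⟩ := hf K hK hKU
    ⟨δ, hδ, fun m => ⟨(h m).1, let ⟨g, hg⟩ := (h m).2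
      ⟨c • g, tendstoUniformlyOn_conv_smul c hg⟩⟩⟩

/-- The subspace of the fundamental sequences equivalent to zero. -/
def null (U : Opens (E N)) : Submodule ℝ (fundamental U) where
  carrier := {f | IsNull (f : ℕ → C(U, ℝ))}
  add_mem' := IsNull.add
  zero_mem' := isNull_zero U
  smul_mem' c _ hf := fun K hK hKU =>
    let ⟨δ, hδ, h⟩ := hf K hK hKU
    ⟨δ, hδ, fun m => ⟨(h m).1, by simpa using tendstoUniformlyOn_conv_smul c (h m).2⟩⟩

/-- The real vector space of Boehmians on `U`: fundamental sequences modulo the relation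
`(f_n) ∼ (g_n)` iff `(f_n - g_n)` is null. -/
abbrev Boehmian (U : Opens (E N)) : Type := fundamental U ⧸ null U

/-- The Boehmian `[(f_n)]` represented by a fundamental sequence. -/
abbrev Boehmian.mk {U : Opens (E N)} (f : fundamental U) : Boehmian U := (null U).mkQ f

theorem Boehmian.mk_eq_mk_iff {U : Opens (E N)} (f g : fundamental U) :
    Boehmian.mk f = Boehmian.mk g ↔ IsNull (fun n => f.1 n - g.1 n) :=
  Submodule.Quotient.eq (null U)

/-! ### Restriction and the presheaf of Boehmians -/

/-- Restriction of a continuous function to a smaller open set. -/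
def restrictFun {U V : Opens (E N)} (h : V ≤ U) (f : C(U, ℝ)) : C(V, ℝ) :=
  f.comp ⟨Set.inclusion h, continuous_inclusion h⟩

theorem conv_restrictFun {U V : Opens (E N)} (h : V ≤ U) (f : C(U, ℝ)) (φ : E N → ℝ)
    {K : Set (E N)} (hK : ConvDefinedOn V φ K) : EqOn (conv f φ) (conv (restrictFun h f) φ) K := by
  intro x hx
  rw [conv_eq_cutoff f φ x V (hK x hx), conv_eq_cutoff _ φ x V (hK x hx)]
  congr 1
  ext y
  by_cases hy : y ∈ (V : Set (E N))
  · rw [indicator_of_mem hy, indicator_of_mem hy, zeroExtend_apply _ hy, zeroExtend_apply _ (h hy)]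
    rfl
  · rw [indicator_of_notMem hy, indicator_of_notMem hy]

theorem IsFundamental.restrict {U V : Opens (E N)} (h : V ≤ U) {f : ℕ → C(U, ℝ)}
    (hf : IsFundamental f) : IsFundamental (fun n => restrictFun h (f n)) := by
  intro K hK hKV
  obtain ⟨δ, hδ, hc⟩ := hf K hK (hKV.trans h)
  obtain ⟨M, hM⟩ := hδ.exists_convDefinedOn hK hKV
  refine ⟨_, hδ.shift M, fun m => ⟨hM m, ?_⟩⟩
  obtain ⟨-, g, hg⟩ := hc (m + M)
  exact ⟨g, hg.congr (Eventually.of_forall fun n => conv_restrictFun h (f n) _ (hM m))⟩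

theorem IsNull.restrict {U V : Opens (E N)} (h : V ≤ U) {f : ℕ → C(U, ℝ)}
    (hf : IsNull f) : IsNull (fun n => restrictFun h (f n)) := by
  intro K hK hKV
  obtain ⟨δ, hδ, hc⟩ := hf K hK (hKV.trans h)
  obtain ⟨M, hM⟩ := hδ.exists_convDefinedOn hK hKV
  exact ⟨_, hδ.shift M, fun m => ⟨hM m, (hc (m + M)).2.congr
    (Eventually.of_forall fun n => conv_restrictFun h (f n) _ (hM m))⟩⟩

/-- Termwise restriction of fundamental sequences. -/
def restrictSeq {U V : Opens (E N)} (h : V ≤ U) : fundamental U →ₗ[ℝ] fundamental V where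
  toFun f := ⟨fun n => restrictFun h (f.1 n), IsFundamental.restrict h f.2⟩
  map_add' _ _ := rfl
  map_smul' _ _ := rfl

/-- The restriction map `[(f_n)] ↦ [(f_n|_V)]` for open sets `V ⊆ U`. -/
def restrict {U V : Opens (E N)} (h : V ≤ U) : Boehmian U →ₗ[ℝ] Boehmian V :=
  (null U).mapQ (null V) (restrictSeq h) fun _ hf => IsNull.restrict h hf

theorem restrict_mk {U V : Opens (E N)} (h : V ≤ U) (f : fundamental U) :
    restrict h (Boehmian.mk f) = Boehmian.mk (restrictSeq h f) := rfl

theorem restrict_refl (U : Opens (E N)) (F : Boehmian U) : restrict le_rfl F = F := by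
  obtain ⟨f, rfl⟩ := (null U).mkQ_surjective F
  rfl

theorem restrict_restrict {U V W : Opens (E N)} (hWV : W ≤ V) (hVU : V ≤ U) (F : Boehmian U) :
    restrict hWV (restrict hVU F) = restrict (hWV.trans hVU) F := by
  obtain ⟨f, rfl⟩ := (null U).mkQ_surjective F
  rfl

/-- The presheaf of real vector spaces `U ↦ 𝔅(U)` on `ℝ^N`. -/
noncomputable def presheaf (N : ℕ) : TopCat.Presheaf (ModuleCat.{0} ℝ) (TopCat.of (E N)) where
  obj U := ModuleCat.of ℝ (Boehmian U.unop)
  map i := ModuleCat.ofHom (restrict i.unop.le)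
  map_id U := by
    refine ModuleCat.hom_ext (LinearMap.ext fun F => ?_)
    exact restrict_refl U.unop F
  map_comp i j := by
    refine ModuleCat.hom_ext (LinearMap.ext fun F => ?_)
    exact (restrict_restrict j.unop.le i.unop.le F).symm

end Boehmians

namespace Boehmians

open MeasureTheory TopologicalSpace Set Filter Metric CategoryTheory Opposite
open scoped Topology ContDiff Convolution Pointwise

variable {N : ℕ}

local notation:67 φ:68 " ⋆ₜ " ψ:67 => convolution φ ψ (ContinuousLinearMap.mul ℝ ℝ) volume

/-! ### Convolution with unit test functions -/

/-! The delta sequence in the definitions depends on the compact set, so the main difficulty is to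
serve several compact sets with one delta sequence. Convolving once more with a test function of
small support averages values and does not increase uniform bounds. Conditions such as "`h_n ∗ φ →
0` uniformly on `K`" therefore survive such convolutions, and the product of two delta sequences
serves two conditions at once (`Attained.and`). Covering a compact set by finitely many small balls
then shows that being null, or fundamental, is a local property (`isNull_of_locally`,
`isFundamental_of_locally`). Locality follows at once.

For gluing, choose countably many balls that cover `U`, each with its double inside some `U_α`. At
stage `j` pick one test function `φ_j`, supported in a ball of radius `1/(j+1)`, that works on
finitely many of the doubled balls and on their overlaps. The limits of `f_n ∗ φ_j` there agree on
overlaps and extend to a continuous `g_j` on the whole space (`exists_glued_limit`). The sequence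
`(g_j)` represents each given Boehmian on each ball (`isNull_restrict_sub`), since `g_j ∗ η` is the
limit of `(f_n ∗ η) ∗ φ_j`, which is close to `f_j ∗ η` for large `j`. Locality of nullness and
fundamentality then carries this from the balls to all `U_α` and to `U`. -/

theorem convolution_assoc_unitTest {F φ ψ : E N → ℝ} (hF : LocallyIntegrable F)
    (hφ : IsUnitTest φ) (hψ : IsUnitTest ψ) : (F ⋆ₜ φ) ⋆ₜ ψ = F ⋆ₜ (φ ⋆ₜ ψ) := by
  have hnn : ∀ χ : E N → ℝ, IsUnitTest χ → (fun x => ‖χ x‖) = χ := fun χ hχ =>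
    funext fun x => by rw [Real.norm_eq_abs, abs_of_nonneg (hχ.nonneg x)]
  ext x
  refine convolution_assoc _ _ _ _ (fun a b c => mul_assoc a b c)
    hF.aestronglyMeasurable hφ.continuous.aestronglyMeasurable
    hψ.continuous.aestronglyMeasurable
    (Eventually.of_forall (hφ.compact.convolutionExists_right _ hF hφ.continuous)) ?_ ?_
  · rw [hnn φ hφ, hnn ψ hψ]
    exact Eventually.of_forall (hψ.compact.convolutionExists_right _
      hφ.continuous.locallyIntegrable hψ.continuous)
  · rw [hnn φ hφ, hnn ψ hψ]
    exact (hφ.convolution hψ).compact.convolutionExists_right _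
      (fun y => (hF y).norm) (hφ.convolution hψ).continuous x

theorem convolution_comm_real (φ ψ : E N → ℝ) : φ ⋆ₜ ψ = ψ ⋆ₜ φ := by
  rw [← convolution_flip]
  congr 1
  ext
  simp

theorem convolution_left_comm_unitTest {φ ψ χ : E N → ℝ} (hφ : IsUnitTest φ) (hψ : IsUnitTest ψ)
    (hχ : IsUnitTest χ) : (φ ⋆ₜ ψ) ⋆ₜ χ = ψ ⋆ₜ (φ ⋆ₜ χ) := by
  rw [convolution_comm_real φ ψ,
    convolution_assoc_unitTest hψ.continuous.locallyIntegrable hφ hχ]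

theorem tsupport_conv_subset_ball {φ ψ : E N → ℝ} (hφ : IsUnitTest φ) (hψ : IsUnitTest ψ)
    {a b c : ℝ} (ha : tsupport φ ⊆ ball 0 a) (hb : tsupport ψ ⊆ ball 0 b) (hc : a + b ≤ c) :
    tsupport (φ ⋆ₜ ψ) ⊆ ball 0 c := by
  intro x hx
  obtain ⟨y, hy, z, hz, rfl⟩ := tsupport_conv_subset hφ hψ hx
  have hy := ha hy
  have hz := hb hz
  rw [mem_ball_zero_iff] at *
  linarith [norm_add_le y z]

/-- Convolution with `ψ` is an average against a probability density, so only the values on `x -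
tsupport ψ` enter the bound. -/
theorem abs_convolution_sub_le {H H' ψ : E N → ℝ} (hH : Continuous H) (hH' : Continuous H')
    (hψ : IsUnitTest ψ) {x : E N} {c : ℝ} (h : ∀ y ∈ tsupport ψ, |H (x - y) - H' (x - y)| ≤ c) :
    |(H ⋆ₜ ψ) x - (H' ⋆ₜ ψ) x| ≤ c := by
  have e := hψ.compact.convolutionExists_right (ContinuousLinearMap.mul ℝ ℝ)
    hH.locallyIntegrable (μ := volume) hψ.continuous x
  have e' := hψ.compact.convolutionExists_right (ContinuousLinearMap.mul ℝ ℝ)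
    hH'.locallyIntegrable (μ := volume) hψ.continuous x
  have hb : ∀ t, ‖ContinuousLinearMap.mul ℝ ℝ (H (x - t)) (ψ t) -
      ContinuousLinearMap.mul ℝ ℝ (H' (x - t)) (ψ t)‖ ≤ c * ψ t := by
    intro t
    rw [ContinuousLinearMap.mul_apply', ContinuousLinearMap.mul_apply', ← sub_mul, norm_mul,
      Real.norm_eq_abs, Real.norm_eq_abs, abs_of_nonneg (hψ.nonneg t)]
    by_cases ht : t ∈ tsupport ψ
    · exact mul_le_mul_of_nonneg_right (h t ht) (hψ.nonneg t)
    · simp [image_eq_zero_of_notMem_tsupport ht]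
  rw [convolution_eq_swap, convolution_eq_swap, ← Real.norm_eq_abs,
    ← integral_sub e.integrable_swap e'.integrable_swap]
  refine (norm_integral_le_of_norm_le (hψ.integrable.const_mul c)
    (Eventually.of_forall hb)).trans ?_
  rw [integral_const_mul, hψ.integral_eq_one, mul_one]

theorem const_convolution {ψ : E N → ℝ} (hψ : IsUnitTest ψ) (c : ℝ) (x : E N) :
    ((fun _ => c) ⋆ₜ ψ) x = c := by
  rw [convolution_eq_swap]
  simp only [ContinuousLinearMap.mul_apply']
  rw [integral_const_mul, hψ.integral_eq_one, mul_one]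

theorem ConvDefinedOn.mono {U U' : Set (E N)} {φ : E N → ℝ} {K K' : Set (E N)}
    (h : ConvDefinedOn U φ K) (hU : U ⊆ U') (hK : K' ⊆ K) : ConvDefinedOn U' φ K' :=
  fun x hx y hy => hU (h x (hK hx) y hy)

theorem ConvDefinedOn.convolution {U K' : Set (E N)} {φ ψ : E N → ℝ} {K : Set (E N)}
    (hφ : IsUnitTest φ) (hψ : IsUnitTest ψ) (h : ConvDefinedOn U φ K')
    (h' : ConvDefinedOn K' ψ K) : ConvDefinedOn U (φ ⋆ₜ ψ) K := by
  intro x hx y hy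
  obtain ⟨a, ha, b, hb, rfl⟩ := tsupport_conv_subset hφ hψ hy
  have := h _ (h' x hx b hb) a ha
  rwa [sub_sub, add_comm] at this

theorem convDefinedOn_of_thickening {φ : E N → ℝ} {ε : ℝ} (hφ : tsupport φ ⊆ ball 0 ε)
    {K K' : Set (E N)} (hK : cthickening ε K ⊆ K') : ConvDefinedOn K' φ K := by
  intro x hx y hy
  refine hK (mem_cthickening_of_dist_le _ x _ _ hx ?_)
  have := hφ hy
  rw [mem_ball_zero_iff] at this
  rw [dist_eq_norm, sub_sub_cancel_left, norm_neg]
  exact this.le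

theorem convDefinedOn_of_closedBall {φ : E N → ℝ} {ε : ℝ} (hφ : tsupport φ ⊆ ball 0 ε)
    {K K' : Set (E N)} (hK : ∀ x ∈ K, closedBall x ε ⊆ K') : ConvDefinedOn K' φ K := by
  intro x hx y hy
  have := hφ hy
  rw [mem_ball_zero_iff] at this
  refine hK x hx ?_
  rw [mem_closedBall, dist_eq_norm, sub_sub_cancel_left, norm_neg]
  exact this.le

/-- On a compact set, a local convolution agrees with a globally defined continuous function, whose
further convolutions are those of the original function. -/
theorem exists_continuous_eq_conv {U : Opens (E N)} (f : C(U, ℝ)) {φ : E N → ℝ}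
    (hφ : IsUnitTest φ) {K : Set (E N)} (hK : IsCompact K) (h : ConvDefinedOn U φ K) :
    ∃ H : E N → ℝ, Continuous H ∧ EqOn (conv f φ) H K ∧ ∀ ψ : E N → ℝ, IsUnitTest ψ →
      ∀ x, (∀ y ∈ tsupport ψ, x - y ∈ K) → conv f (φ ⋆ₜ ψ) x = (H ⋆ₜ ψ) x := by
  -- All points of `U` seen by the convolution from `K`. Cutting `f` off to this compact set leaves
  -- the values on `K` unchanged and gives a globally integrable function, to which associativity
  -- applies.
  let C : Set (E N) := (fun p : E N × E N => p.1 - p.2) '' (K ×ˢ tsupport φ)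
  have hC : IsCompact C := (hK.prod hφ.compact.isCompact).image (by fun_prop)
  have hCU : C ⊆ U := by
    rintro _ ⟨⟨x, y⟩, ⟨hx, hy⟩, rfl⟩
    exact h x hx y hy
  have hF : Integrable (C.indicator (zeroExtend f)) := integrable_cutoff f hC hCU
  refine ⟨C.indicator (zeroExtend f) ⋆ₜ φ,
    hφ.compact.continuous_convolution_right _ hF.locallyIntegrable hφ.continuous,
    fun x hx => conv_eq_cutoff f φ x C fun y hy => ⟨(x, y), ⟨hx, hy⟩, rfl⟩,
    fun ψ hψ x hx => ?_⟩
  rw [convolution_assoc_unitTest hF.locallyIntegrable hφ hψ]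
  refine conv_eq_cutoff f _ x C fun y hy => ?_
  obtain ⟨a, ha, b, hb, rfl⟩ := tsupport_conv_subset hφ hψ hy
  exact ⟨(x - b, a), ⟨hx b hb, ha⟩, by simp only; abel⟩

theorem continuousOn_conv {U : Opens (E N)} (f : C(U, ℝ)) {φ : E N → ℝ}
    (hφ : IsUnitTest φ) {K : Set (E N)} (hK : IsCompact K) (h : ConvDefinedOn U φ K) :
    ContinuousOn (conv f φ) K := by
  obtain ⟨H, hH, hHK, -⟩ := exists_continuous_eq_conv f hφ hK h
  exact hH.continuousOn.congr hHK

theorem conv_restrict {U : Opens (E N)} (g : C(E N, ℝ)) {φ : E N → ℝ} {x : E N}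
    (h : ∀ y ∈ tsupport φ, x - y ∈ U) : conv (g.restrict (U : Set (E N))) φ x = (g ⋆ₜ φ) x := by
  rw [conv, convolution_def, convolution_def]
  congr 1
  ext t
  by_cases ht : t ∈ U
  · rw [zeroExtend_apply _ ht]
    rfl
  · have : φ (x - t) = 0 := by
      by_contra h0
      exact ht (by simpa using h _ (subset_tsupport _ h0))
    simp [this]

/-! ### Properties attained along delta sequences -/

/-- A property of test functions that holds along some delta sequence, stably under
convolution with test functions of small support. -/
def Attained (P : (E N → ℝ) → Prop) : Prop :=
  ∃ δ : ℕ → E N → ℝ, IsDelta δ ∧ ∃ ε > 0, ∀ m ψ, IsUnitTest ψ → tsupport ψ ⊆ ball 0 ε →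
    P (δ m ⋆ₜ ψ)

theorem Attained.mono {P Q : (E N → ℝ) → Prop} (hP : Attained P)
    (h : ∀ φ, IsUnitTest φ → P φ → Q φ) : Attained Q :=
  let ⟨δ, hδ, ε, hε, hδP⟩ := hP
  ⟨δ, hδ, ε, hε, fun m ψ hψ hs => h _ ((hδ.test m).convolution hψ) (hδP m ψ hψ hs)⟩

theorem attained_true : Attained (fun _ : E N → ℝ => True) :=
  let ⟨δ, hδ⟩ := exists_isDelta N
  ⟨δ, hδ, 1, one_pos, fun _ _ _ _ => trivial⟩

/-- The product `δ_m ⋆ η_m ⋆ ψ` is `δ_m` smoothed by `η_m ⋆ ψ`, and also `η_m` smoothed by `δ_m ⋆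
ψ`. The first reading gives `P`, the second `Q`. -/
theorem Attained.and {P Q : (E N → ℝ) → Prop} (hP : Attained P) (hQ : Attained Q) :
    Attained (fun φ => P φ ∧ Q φ) := by
  obtain ⟨δ, hδ, ε, hε, hδP⟩ := hP
  obtain ⟨η, hη, ε', hε', hηQ⟩ := hQ
  -- The radii are crossed: `η` must be small for the tolerance `ε` of `P`, and `δ` for the
  -- tolerance `ε'` of `Q`. The other half of each tolerance is left for `ψ`.
  obtain ⟨M, hM⟩ := eventually_atTop.1
    ((hδ.eventually (half_pos hε')).and (hη.eventually (half_pos hε)))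
  refine ⟨_, (hδ.shift M).convolution (hη.shift M), min (ε / 2) (ε' / 2),
    lt_min (half_pos hε) (half_pos hε'), fun m ψ hψ hs => ⟨?_, ?_⟩⟩
  · rw [convolution_assoc_unitTest (hδ.test _).continuous.locallyIntegrable (hη.test _) hψ]
    exact hδP _ _ ((hη.test _).convolution hψ) (tsupport_conv_subset_ball (hη.test _) hψ
      (hM _ (Nat.le_add_left M m)).2 hs (by linarith [min_le_left (ε / 2) (ε' / 2)]))
  · rw [convolution_left_comm_unitTest (hδ.test _) (hη.test _) hψ]
    exact hηQ _ _ ((hδ.test _).convolution hψ) (tsupport_conv_subset_ball (hδ.test _) hψ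
      (hM _ (Nat.le_add_left M m)).1 hs (by linarith [min_le_right (ε / 2) (ε' / 2)]))

theorem Attained.forall_mem_finset {ι : Type*} {P : ι → (E N → ℝ) → Prop} (s : Finset ι)
    (h : ∀ i ∈ s, Attained (P i)) : Attained (fun φ => ∀ i ∈ s, P i φ) := by
  classical
  induction s using Finset.induction_on with
  | empty => exact attained_true.mono fun φ _ _ => by simp
  | insert a s _ ih =>
    rw [Finset.forall_mem_insert] at h
    exact (h.1.and (ih h.2)).mono fun φ _ hφ => by rwa [Finset.forall_mem_insert]

/-- The property is known only for products `δ_m ⋆ ψ`, so a tail of the delta sequence is convolved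
with itself. -/
theorem Attained.exists_isDelta {P : (E N → ℝ) → Prop} (hP : Attained P) :
    ∃ δ : ℕ → E N → ℝ, IsDelta δ ∧ ∀ m, P (δ m) := by
  obtain ⟨δ, hδ, ε, hε, h⟩ := hP
  obtain ⟨M, hM⟩ := eventually_atTop.1 (hδ.eventually hε)
  exact ⟨_, (hδ.shift M).convolution (hδ.shift M), fun m =>
    h _ _ (hδ.test _) (hM _ (Nat.le_add_left M m))⟩

theorem Attained.exists_isUnitTest {P : (E N → ℝ) → Prop} (hP : Attained P) {ε : ℝ} (hε : 0 < ε) :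
    ∃ φ : E N → ℝ, IsUnitTest φ ∧ tsupport φ ⊆ ball 0 ε ∧ P φ :=
  let ⟨_, hδ, h⟩ := hP.exists_isDelta
  let ⟨m, hm⟩ := (hδ.eventually hε).exists
  ⟨_, hδ.test m, hm, h m⟩

theorem attained_tsupport_subset {ε : ℝ} (hε : 0 < ε) :
    Attained (fun φ : E N → ℝ => tsupport φ ⊆ ball 0 ε) := by
  obtain ⟨δ, hδ⟩ := Boehmians.exists_isDelta N
  obtain ⟨M, hM⟩ := eventually_atTop.1 (hδ.eventually (half_pos hε))
  exact ⟨_, hδ.shift M, ε / 2, half_pos hε, fun m ψ hψ hs =>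
    tsupport_conv_subset_ball (hδ.test _) hψ (hM _ (Nat.le_add_left M m)) hs (by linarith)⟩

/-! ### Convergence of convolutions over a set -/

/-- The convolutions `h_n ∗ φ` are defined on `K` and tend to zero uniformly on `K`. -/
def NullOn {U : Opens (E N)} (h : ℕ → C(U, ℝ)) (φ : E N → ℝ) (K : Set (E N)) : Prop :=
  ConvDefinedOn U φ K ∧ ∀ c > 0, ∃ n₀, ∀ n ≥ n₀, ∀ x ∈ K, |conv (h n) φ x| ≤ c

/-- The convolutions `f_n ∗ φ` are defined on `K` and uniformly Cauchy on `K`. -/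
def CauchyOn {U : Opens (E N)} (f : ℕ → C(U, ℝ)) (φ : E N → ℝ) (K : Set (E N)) : Prop :=
  ConvDefinedOn U φ K ∧ ∀ c > 0, ∃ n₀, ∀ n ≥ n₀, ∀ p ≥ n₀, ∀ x ∈ K, |conv (f n - f p) φ x| ≤ c

theorem nullOn_iff {U : Opens (E N)} {h : ℕ → C(U, ℝ)} {φ : E N → ℝ} {K : Set (E N)} :
    NullOn h φ K ↔
      ConvDefinedOn U φ K ∧ TendstoUniformlyOn (fun n => conv (h n) φ) 0 atTop K := by
  refine and_congr_right fun _ => ⟨fun H => ?_, fun H c hc => ?_⟩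
  · rw [Metric.tendstoUniformlyOn_iff]
    intro c hc
    obtain ⟨n₀, h₀⟩ := H (c / 2) (half_pos hc)
    filter_upwards [eventually_ge_atTop n₀] with n hn x hx
    rw [Pi.zero_apply, dist_zero_left, Real.norm_eq_abs]
    linarith [h₀ n hn x hx]
  · obtain ⟨n₀, h₀⟩ := eventually_atTop.1 (Metric.tendstoUniformlyOn_iff.1 H c hc)
    exact ⟨n₀, fun n hn x hx => by simpa using (h₀ n hn x hx).le⟩

theorem CauchyOn.uniformCauchySeqOn {U : Opens (E N)} {f : ℕ → C(U, ℝ)} {φ : E N → ℝ}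
    (hφ : IsUnitTest φ) {K : Set (E N)} (h : CauchyOn f φ K) :
    UniformCauchySeqOn (fun n => conv (f n) φ) atTop K := by
  rw [Metric.uniformCauchySeqOn_iff]
  intro c hc
  obtain ⟨n₀, h₀⟩ := h.2 (c / 2) (half_pos hc)
  refine ⟨n₀, fun n hn p hp x hx => ?_⟩
  rw [Real.dist_eq, ← conv_sub _ _ hφ (h.1 x hx)]
  linarith [h₀ n hn p hp x hx]

theorem CauchyOn.of_uniformCauchySeqOn {U : Opens (E N)} {f : ℕ → C(U, ℝ)} {φ : E N → ℝ}
    (hφ : IsUnitTest φ) {K : Set (E N)} (hK : ConvDefinedOn U φ K)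
    (h : UniformCauchySeqOn (fun n => conv (f n) φ) atTop K) : CauchyOn f φ K := by
  refine ⟨hK, fun c hc => ?_⟩
  obtain ⟨n₀, h₀⟩ := Metric.uniformCauchySeqOn_iff.1 h c hc
  refine ⟨n₀, fun n hn p hp x hx => ?_⟩
  rw [conv_sub _ _ hφ (hK x hx), ← Real.dist_eq]
  exact (h₀ n hn p hp x hx).le

theorem CauchyOn.exists_tendsto {U : Opens (E N)} {f : ℕ → C(U, ℝ)} {φ : E N → ℝ}
    (hφ : IsUnitTest φ) {K : Set (E N)} (h : CauchyOn f φ K) {x : E N} (hx : x ∈ K) :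
    ∃ y, Tendsto (fun n => conv (f n) φ x) atTop (𝓝 y) :=
  cauchySeq_tendsto_of_complete ((h.uniformCauchySeqOn hφ).cauchySeq hx)

theorem CauchyOn.exists_tendstoUniformlyOn {U : Opens (E N)} {f : ℕ → C(U, ℝ)} {φ : E N → ℝ}
    (hφ : IsUnitTest φ) {K : Set (E N)} (h : CauchyOn f φ K) :
    ∃ g : E N → ℝ, TendstoUniformlyOn (fun n => conv (f n) φ) g atTop K := by
  have hlim : ∀ x, ∃ y, x ∈ K → Tendsto (fun n => conv (f n) φ x) atTop (𝓝 y) := by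
    intro x
    by_cases hx : x ∈ K
    · obtain ⟨y, hy⟩ := h.exists_tendsto hφ hx
      exact ⟨y, fun _ => hy⟩
    · exact ⟨0, fun h => absurd h hx⟩
  choose L hL using hlim
  exact ⟨L, (h.uniformCauchySeqOn hφ).tendstoUniformlyOn_of_tendsto fun x hx => hL x hx⟩

/-- The delta sequence is taken for a closed `ε`-thickening of `K`. Smoothing by `ψ` supported in
the `ε`-ball then averages, at points of `K`, values over the thickening, where the bounds hold. -/
theorem IsNull.attained {U : Opens (E N)} {h : ℕ → C(U, ℝ)} (hh : IsNull h) {K : Set (E N)}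
    (hK : IsCompact K) (hKU : K ⊆ U) : Attained (fun φ => NullOn h φ K) := by
  obtain ⟨ε, hε, hK', hK'U⟩ := exists_thickening hK hKU
  obtain ⟨δ, hδ, hδh⟩ := hh _ hK' hK'U
  refine ⟨δ, hδ, ε, hε, fun m ψ hψ hs => ?_⟩
  have hd := nullOn_iff.2 (hδh m)
  have hd' := convDefinedOn_of_thickening hs (subset_refl (cthickening ε K))
  refine ⟨hd.1.convolution (hδ.test m) hψ hd', fun c hc => ?_⟩
  obtain ⟨n₀, h₀⟩ := hd.2 c hc
  exact ⟨n₀, fun n hn => abs_conv_convolution_le _ (hδ.test m) hψ hd.1 hd' (h₀ n hn)⟩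

theorem IsFundamental.attained {U : Opens (E N)} {f : ℕ → C(U, ℝ)} (hf : IsFundamental f)
    {K : Set (E N)} (hK : IsCompact K) (hKU : K ⊆ U) : Attained (fun φ => CauchyOn f φ K) := by
  obtain ⟨ε, hε, hK', hK'U⟩ := exists_thickening hK hKU
  obtain ⟨δ, hδ, hδh⟩ := hf _ hK' hK'U
  refine ⟨δ, hδ, ε, hε, fun m ψ hψ hs => ?_⟩
  have hd := CauchyOn.of_uniformCauchySeqOn (hδ.test m) (hδh m).1
    (hδh m).2.choose_spec.uniformCauchySeqOn
  have hd' := convDefinedOn_of_thickening hs (subset_refl (cthickening ε K))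
  refine ⟨hd.1.convolution (hδ.test m) hψ hd', fun c hc => ?_⟩
  obtain ⟨n₀, h₀⟩ := hd.2 c hc
  exact ⟨n₀, fun n hn p hp =>
    abs_conv_convolution_le _ (hδ.test m) hψ hd.1 hd' (h₀ n hn p hp)⟩

theorem isNull_of_attained {U : Opens (E N)} {h : ℕ → C(U, ℝ)}
    (hh : ∀ K : Set (E N), IsCompact K → K ⊆ U → Attained (fun φ => NullOn h φ K)) :
    IsNull h := fun K hK hKU =>
  let ⟨δ, hδ, H⟩ := (hh K hK hKU).exists_isDelta
  ⟨δ, hδ, fun m => nullOn_iff.1 (H m)⟩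

theorem isFundamental_of_attained {U : Opens (E N)} {f : ℕ → C(U, ℝ)}
    (hf : ∀ K : Set (E N), IsCompact K → K ⊆ U → Attained (fun φ => CauchyOn f φ K)) :
    IsFundamental f := fun K hK hKU =>
  let ⟨δ, hδ, H⟩ := (hf K hK hKU).exists_isDelta
  ⟨δ, hδ, fun m => ⟨(H m).1, (H m).exists_tendstoUniformlyOn (hδ.test m)⟩⟩

/-! ### Locality -/

theorem NullOn.mono {U : Opens (E N)} {h : ℕ → C(U, ℝ)} {φ : E N → ℝ} {K K' : Set (E N)}
    (hK : NullOn h φ K) (hs : K' ⊆ K) : NullOn h φ K' :=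
  ⟨hK.1.mono subset_rfl hs, fun c hc =>
    let ⟨n₀, h₀⟩ := hK.2 c hc
    ⟨n₀, fun n hn x hx => h₀ n hn x (hs hx)⟩⟩

theorem NullOn.union {U : Opens (E N)} {h : ℕ → C(U, ℝ)} {φ : E N → ℝ} {K K' : Set (E N)}
    (hK : NullOn h φ K) (hK' : NullOn h φ K') : NullOn h φ (K ∪ K') := by
  refine ⟨fun x hx => hx.elim (hK.1 x) (hK'.1 x), fun c hc => ?_⟩
  obtain ⟨n₀, h₀⟩ := hK.2 c hc
  obtain ⟨n₁, h₁⟩ := hK'.2 c hc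
  exact ⟨max n₀ n₁, fun n hn x hx => hx.elim (h₀ n (le_of_max_le_left hn) x)
    (h₁ n (le_of_max_le_right hn) x)⟩

/-- A convolution that is already defined over `V` sees only values on `V`. -/
theorem NullOn.of_restrict {U V : Opens (E N)} (hVU : V ≤ U) {h : ℕ → C(U, ℝ)} {φ : E N → ℝ}
    {K : Set (E N)} (hK : NullOn (fun n => restrictFun hVU (h n)) φ K) : NullOn h φ K := by
  refine ⟨hK.1.mono hVU subset_rfl, fun c hc => ?_⟩
  obtain ⟨n₀, h₀⟩ := hK.2 c hc
  refine ⟨n₀, fun n hn x hx => ?_⟩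
  rw [conv_restrictFun hVU (h n) φ hK.1 hx]
  exact h₀ n hn x hx

theorem CauchyOn.mono {U : Opens (E N)} {h : ℕ → C(U, ℝ)} {φ : E N → ℝ} {K K' : Set (E N)}
    (hK : CauchyOn h φ K) (hs : K' ⊆ K) : CauchyOn h φ K' :=
  ⟨hK.1.mono subset_rfl hs, fun c hc =>
    let ⟨n₀, h₀⟩ := hK.2 c hc
    ⟨n₀, fun n hn p hp x hx => h₀ n hn p hp x (hs hx)⟩⟩

theorem CauchyOn.union {U : Opens (E N)} {h : ℕ → C(U, ℝ)} {φ : E N → ℝ} {K K' : Set (E N)}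
    (hK : CauchyOn h φ K) (hK' : CauchyOn h φ K') : CauchyOn h φ (K ∪ K') := by
  refine ⟨fun x hx => hx.elim (hK.1 x) (hK'.1 x), fun c hc => ?_⟩
  obtain ⟨n₀, h₀⟩ := hK.2 c hc
  obtain ⟨n₁, h₁⟩ := hK'.2 c hc
  exact ⟨max n₀ n₁, fun n hn p hp x hx =>
    hx.elim (h₀ n (le_of_max_le_left hn) p (le_of_max_le_left hp) x)
    (h₁ n (le_of_max_le_right hn) p (le_of_max_le_right hp) x)⟩

theorem CauchyOn.of_restrict {U V : Opens (E N)} (hVU : V ≤ U) {h : ℕ → C(U, ℝ)} {φ : E N → ℝ}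
    {K : Set (E N)} (hK : CauchyOn (fun n => restrictFun hVU (h n)) φ K) : CauchyOn h φ K := by
  refine ⟨hK.1.mono hVU subset_rfl, fun c hc => ?_⟩
  obtain ⟨n₀, h₀⟩ := hK.2 c hc
  refine ⟨n₀, fun n hn p hp x hx => ?_⟩
  rw [conv_restrictFun hVU (h n - h p) φ hK.1 hx]
  exact h₀ n hn p hp x hx

/-- A property of compact sets that is attained locally is attained on every compact set. -/
theorem attained_of_locally {U : Opens (E N)} {P : (E N → ℝ) → Set (E N) → Prop}
    (hmono : ∀ φ K K', K' ⊆ K → P φ K → P φ K') (hempty : ∀ φ, P φ ∅)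
    (hunion : ∀ φ K K', P φ K → P φ K' → P φ (K ∪ K'))
    (h : ∀ x ∈ U, ∃ V ≤ U, x ∈ V ∧
      ∀ K : Set (E N), IsCompact K → K ⊆ V → Attained (fun φ => P φ K))
    {K : Set (E N)} (hK : IsCompact K) (hKU : K ⊆ U) : Attained (fun φ => P φ K) := by
  -- Induction over finite unions of small sets. The union step needs one test function for both
  -- pieces, which `Attained.and` supplies.
  refine hK.induction_on (p := fun S => Attained (fun φ => P φ S))
    (attained_true.mono fun φ _ _ => hempty φ)
    (fun s t hst ht => ht.mono fun φ _ => hmono φ t s hst)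
    (fun s t hs ht => (hs.and ht).mono fun φ _ H => hunion φ s t H.1 H.2) fun x hx => ?_
  obtain ⟨V, -, hxV, hV⟩ := h x (hKU hx)
  obtain ⟨r, hr, hrV⟩ := nhds_basis_closedBall.mem_iff.1 (V.isOpen.mem_nhds hxV)
  exact ⟨closedBall x r, mem_nhdsWithin_of_mem_nhds (closedBall_mem_nhds x hr),
    hV _ (isCompact_closedBall x r) hrV⟩

/-- Locality at the level of representatives; also used in gluing to pass from balls to the sets
`U_α`. -/
theorem isNull_of_locally {U : Opens (E N)} {h : ℕ → C(U, ℝ)}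
    (H : ∀ x ∈ U, ∃ V, ∃ hVU : V ≤ U, x ∈ V ∧ IsNull (fun n => restrictFun hVU (h n))) :
    IsNull h :=
  isNull_of_attained fun _ => attained_of_locally (fun _ _ _ hs hK => hK.mono hs)
    (fun _ => ⟨fun _ hx => hx.elim, fun _ _ => ⟨0, fun _ _ _ hx => hx.elim⟩⟩)
    (fun _ _ _ => NullOn.union) fun x hx =>
      let ⟨V, hVU, hxV, hV⟩ := H x hx
      ⟨V, hVU, hxV, fun _ hK hKV => (hV.attained hK hKV).mono fun _ _ => NullOn.of_restrict hVU⟩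

theorem isFundamental_of_locally {U : Opens (E N)} {f : ℕ → C(U, ℝ)}
    (H : ∀ x ∈ U, ∃ V, ∃ hVU : V ≤ U, x ∈ V ∧ IsFundamental (fun n => restrictFun hVU (f n))) :
    IsFundamental f :=
  isFundamental_of_attained fun _ => attained_of_locally (fun _ _ _ hs hK => hK.mono hs)
    (fun _ => ⟨fun _ hx => hx.elim, fun _ _ => ⟨0, fun _ _ _ _ _ hx => hx.elim⟩⟩)
    (fun _ _ _ => CauchyOn.union) fun x hx =>
      let ⟨V, hVU, hxV, hV⟩ := H x hx
      ⟨V, hVU, hxV, fun _ hK hKV =>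
        (hV.attained hK hKV).mono fun _ _ => CauchyOn.of_restrict hVU⟩

/-! ### Gluing -/

/-- Finitely many locally defined limits of convolutions that agree on overlaps are
restrictions of one continuous function. -/
theorem exists_glued_limit {κ : Type*} (s : Finset κ) {U : κ → Opens (E N)}
    {f : ∀ k, ℕ → C(U k, ℝ)} {C : κ → Set (E N)} (hC : ∀ k, IsCompact (C k)) {φ : E N → ℝ}
    (hφ : IsUnitTest φ) (hf : ∀ k ∈ s, CauchyOn (f k) φ (C k))
    (hfn : ∀ k ∈ s, ∀ l ∈ s, NullOn (fun n => restrictFun (inf_le_left : U k ⊓ U l ≤ U k) (f k n) -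
      restrictFun (inf_le_right : U k ⊓ U l ≤ U l) (f l n)) φ (C k ∩ C l)) :
    ∃ g : C(E N, ℝ), ∀ k ∈ s, TendstoUniformlyOn (fun n => conv (f k n) φ) g atTop (C k) := by
  have hlim : ∀ x, ∃ y, ∀ k ∈ s, x ∈ C k → Tendsto (fun n => conv (f k n) φ x) atTop (𝓝 y) := by
    intro x
    by_cases hx : ∃ k ∈ s, x ∈ C k
    · obtain ⟨k, hk, hxk⟩ := hx
      obtain ⟨y, hy⟩ := (hf k hk).exists_tendsto hφ hxk
      refine ⟨y, fun l hl hxl => ?_⟩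
      -- The limit found through `k` is also the limit through `l`, because the difference of the
      -- two sequences tends to zero on the overlap.
      have hn := hfn l hl k hk
      have h0 := ((nullOn_iff.1 hn).2.tendsto_at ⟨hxl, hxk⟩).add hy
      rw [Pi.zero_apply, zero_add] at h0
      refine h0.congr fun n => ?_
      rw [conv_sub _ _ hφ (hn.1 x ⟨hxl, hxk⟩), ← conv_restrictFun _ (f l n) φ hn.1 ⟨hxl, hxk⟩,
        ← conv_restrictFun _ (f k n) φ hn.1 ⟨hxl, hxk⟩, sub_add_cancel]
    · exact ⟨0, fun k hk hxk => absurd ⟨k, hk, hxk⟩ hx⟩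
  choose L hL using hlim
  have hLu : ∀ k ∈ s, TendstoUniformlyOn (fun n => conv (f k n) φ) L atTop (C k) := fun k hk =>
    ((hf k hk).uniformCauchySeqOn hφ).tendstoUniformlyOn_of_tendsto fun x hx => hL x k hk hx
  -- Uniform limits are continuous on each closed piece, and finitely many closed pieces can be
  -- pasted.
  have hLc : ContinuousOn L (⋃ k : s, C k) :=
    (locallyFinite_of_finite _).continuousOn_iUnion (fun k => (hC k).isClosed) fun k =>
      (hLu k k.2).continuousOn
        (Eventually.of_forall fun n => continuousOn_conv (f k n) hφ (hC k) (hf k k.2).1).frequently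
  have hcl : IsClosed (⋃ k : s, C k) := isClosed_iUnion_of_finite fun k => (hC k).isClosed
  -- Tietze extension from the closed union to the whole space.
  obtain ⟨g, hg⟩ := ContinuousMap.exists_restrict_eq hcl
    ⟨_, continuousOn_iff_continuous_domRestrict.1 hLc⟩
  refine ⟨g, fun k hk => (hLu k hk).congr_right fun x hx => ?_⟩
  have := DFunLike.congr_fun hg ⟨x, mem_iUnion.2 ⟨⟨k, hk⟩, hx⟩⟩
  exact this.symm

/-- Let `φ_j` be a delta sequence. Continuous functions `g_j` that equal the limit of `f_n ∗ φ_j`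
near an open set `V` represent the same Boehmian on `V` as `(f_n)`. -/
theorem isNull_restrict_sub {U V : Opens (E N)} (hVU : V ≤ U) {f : ℕ → C(U, ℝ)}
    (hf : IsFundamental f) {C : Set (E N)} (hC : IsCompact C) (hCU : C ⊆ U) {ρ : ℝ} (hρ : 0 < ρ)
    (hVC : ∀ x ∈ V, closedBall x ρ ⊆ C) {φ : ℕ → E N → ℝ} (hφ : IsDelta φ) {g : ℕ → C(E N, ℝ)}
    (hg : ∀ᶠ j in atTop, ConvDefinedOn U (φ j) C ∧
      TendstoUniformlyOn (fun n => conv (f n) (φ j)) (g j) atTop C) :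
    IsNull (fun j => (g j).restrict (V : Set (E N)) - restrictFun hVU (f j)) := by
  refine isNull_of_attained fun K hK hKV => ?_
  -- The null sequence `0` contributes only that convolutions with `η` are defined on `K` over `V`.
  refine ((hf.attained hC hCU).and ((attained_tsupport_subset hρ).and
    ((isNull_zero V).attained hK hKV))).mono ?_
  rintro η hη ⟨hfη, hηρ, ⟨hηK, -⟩⟩
  have hKC : ∀ x ∈ K, closedBall x ρ ⊆ C := fun x hx => hVC x (hKV hx)
  have hηC : ConvDefinedOn C η K := convDefinedOn_of_closedBall hηρ hKC
  refine ⟨hηK, fun c hc => ?_⟩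
  -- Four errors of `c / 4` will be added along the chain `g_j ∗ η ≈ f_n ∗ φ_j ∗ η = (f_n ∗ η) ∗ φ_j
  -- ≈ (f_{n₀} ∗ η) ∗ φ_j ≈ f_{n₀} ∗ η ≈ f_j ∗ η`. The index `n₀` is fixed before `j`, so that
  -- uniform continuity of `f_{n₀} ∗ η` on `C` gives a scale `d` valid for all large `j`.
  obtain ⟨n₀, h₀⟩ := hfη.2 (c / 4) (by positivity)
  obtain ⟨H₀, hH₀, hH₀C, hH₀c⟩ := exists_continuous_eq_conv (f n₀) hη hC hfη.1
  obtain ⟨d, hd, hdH⟩ := Metric.uniformContinuousOn_iff.1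
    (hC.uniformContinuousOn_of_continuous hH₀.continuousOn) (c / 4) (by positivity)
  obtain ⟨j₀, hj₀⟩ := eventually_atTop.1
    (((hφ.eventually hd).and (hφ.eventually hρ)).and (hg.and (eventually_ge_atTop n₀)))
  refine ⟨j₀, fun j hj x hx => ?_⟩
  obtain ⟨⟨hφd, hφρ⟩, ⟨hφC, hgj⟩, hnj⟩ := hj₀ j hj
  have hφK : ConvDefinedOn C (φ j) K := convDefinedOn_of_closedBall hφρ hKC
  have hxC : x ∈ C := hKC x hx (mem_closedBall_self hρ.le)
  -- This auxiliary `n` may depend on `j`; it drops out of the final estimate.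
  obtain ⟨n, hn, hnn⟩ := ((Metric.tendstoUniformlyOn_iff.1 hgj (c / 4) (by positivity)).and
    (eventually_ge_atTop n₀)).exists
  obtain ⟨H₁, hH₁, hH₁C, hH₁c⟩ := exists_continuous_eq_conv (f n) (hφ.test j) hC hφC
  have b1 : |((g j : E N → ℝ) ⋆ₜ η) x - (H₁ ⋆ₜ η) x| ≤ c / 4 :=
    abs_convolution_sub_le (g j).continuous hH₁ hη fun y hy => by
      rw [← hH₁C (hηC x hx y hy), ← Real.dist_eq]
      exact (hn _ (hηC x hx y hy)).le
  have b2 := abs_conv_convolution_le (f n - f n₀) hη (hφ.test j) hfη.1 hφK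
    (h₀ n hnn n₀ le_rfl) x hx
  rw [conv_sub _ _ (hη.convolution (hφ.test j)) (hfη.1.convolution hη (hφ.test j) hφK x hx),
    hH₀c _ (hφ.test j) x (hφK x hx), convolution_comm_real η, hH₁c _ hη x (hηC x hx)] at b2
  have b3 : |(H₀ ⋆ₜ φ j) x - ((fun _ => H₀ x) ⋆ₜ φ j) x| ≤ c / 4 :=
    abs_convolution_sub_le hH₀ continuous_const (hφ.test j) fun y hy => by
      rw [← Real.dist_eq]
      refine (hdH _ (hφK x hx y hy) _ hxC ?_).le
      have := hφd hy
      rwa [mem_ball_zero_iff, ← norm_neg, ← sub_sub_cancel_left x y, ← dist_eq_norm] at this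
  rw [const_convolution (hφ.test j), ← hH₀C hxC] at b3
  have b4 := h₀ n₀ le_rfl j hnj x hxC
  rw [conv_sub _ _ hη (hfη.1 x hxC)] at b4
  rw [conv_sub _ _ hη (hηK x hx), conv_restrict (g j) (hηK x hx),
    ← conv_restrictFun hVU (f j) η hηK hx]
  rw [abs_le] at *
  constructor <;> linarith [b1.1, b1.2, b2.1, b2.2, b3.1, b3.2, b4.1, b4.2]

/-- Compatible fundamental sequences around countably many balls are represented, on these balls,
by a single sequence of continuous functions on the whole space. -/
theorem exists_glued_seq {κ : Type*} [Countable κ] {U : κ → Opens (E N)} {f : ∀ k, ℕ → C(U k, ℝ)}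
    (hf : ∀ k, IsFundamental (f k))
    (hfn : ∀ k l, IsNull (fun n => restrictFun (inf_le_left : U k ⊓ U l ≤ U k) (f k n) -
      restrictFun (inf_le_right : U k ⊓ U l ≤ U l) (f l n)))
    {a : κ → E N} {r : κ → ℝ} (hr : ∀ k, 0 < r k) (ha : ∀ k, closedBall (a k) (2 * r k) ⊆ U k) :
    ∃ g : ℕ → C(E N, ℝ), ∀ k (V : Opens (E N)) (hV : V ≤ U k), (V : Set (E N)) ⊆ ball (a k) (r k) →
      IsNull (fun j => (g j).restrict (V : Set (E N)) - restrictFun hV (f k j)) := by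
  set C : κ → Set (E N) := fun k => closedBall (a k) (2 * r k) with hCdef
  have hC : ∀ k, IsCompact (C k) := fun k => isCompact_closedBall _ _
  -- Countability of `κ` gives finite sets `s j` that eventually contain each index, so each `φ j`
  -- below faces only finitely many conditions.
  obtain ⟨s, hs⟩ := exists_seq_tendsto (atTop : Filter (Finset κ))
  have hφ : ∀ j : ℕ, ∃ φ : E N → ℝ, IsUnitTest φ ∧ tsupport φ ⊆ ball 0 (1 / ((j : ℝ) + 1)) ∧
      ((∀ k ∈ s j, CauchyOn (f k) φ (C k)) ∧
      ∀ k ∈ s j, ∀ l ∈ s j, NullOn (fun n =>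
        restrictFun (inf_le_left : U k ⊓ U l ≤ U k) (f k n) -
        restrictFun (inf_le_right : U k ⊓ U l ≤ U l) (f l n)) φ (C k ∩ C l)) := fun j =>
    Attained.exists_isUnitTest
      ((Attained.forall_mem_finset (s j) fun k _ => (hf k).attained (hC k) (ha k)).and
      (Attained.forall_mem_finset (s j) fun k _ => Attained.forall_mem_finset (s j) fun l _ =>
        (hfn k l).attained ((hC k).inter (hC l)) (inter_subset_inter (ha k) (ha l))))
      (by positivity)
  choose φ hφt hφs hφC hφn using hφ
  have hφd : IsDelta φ := isDelta_of hφt fun ε hε => by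
    filter_upwards [(tendsto_one_div_add_atTop_nhds_zero_nat (𝕜 := ℝ)).eventually_lt_const hε]
      with j hj
    exact (hφs j).trans (ball_subset_ball hj.le)
  choose g hg using fun j => exists_glued_limit (s j) hC (hφt j) (hφC j) (hφn j)
  refine ⟨g, fun k V hV hVb => isNull_restrict_sub hV (hf k) (hC k) (ha k) (hr k)
    (fun x hx => closedBall_subset_closedBall' ?_) hφd ?_⟩
  -- Points of `V` are within `r k` of the centre, so doubling the radius leaves a margin `r k` for
  -- convolution.
  · linarith [mem_ball.1 (hVb hx)]
  · filter_upwards [hs.eventually (eventually_ge_atTop {k})] with j hj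
    have hk : k ∈ s j := hj (Finset.mem_singleton_self k)
    exact ⟨(hφC j k hk).1, hg j k hk⟩

/-- The Lindelöf property extracts a countable subcover even if `ι` is uncountable. Each ball keeps
an index `α` that says which sequence to use on it. -/
theorem exists_countable_ball_cover {ι : Type*} (U : ι → Opens (E N)) :
    ∃ (κ : Set (ι × E N × ℝ)), κ.Countable ∧
      (∀ k ∈ κ, 0 < k.2.2 ∧ closedBall k.2.1 (2 * k.2.2) ⊆ U k.1) ∧
      ∀ α, ∀ x ∈ U α, ∃ k ∈ κ, x ∈ ball k.2.1 k.2.2 := by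
  let S : Set (ι × E N × ℝ) := {k | 0 < k.2.2 ∧ closedBall k.2.1 (2 * k.2.2) ⊆ U k.1}
  obtain ⟨T, hT, hTS⟩ := isOpen_iUnion_countable (fun k : S => ball k.1.2.1 k.1.2.2)
    fun _ => isOpen_ball
  refine ⟨(↑) '' T, hT.image _, ?_, fun α x hx => ?_⟩
  · rintro _ ⟨k, -, rfl⟩
    exact k.2
  · obtain ⟨r, hr, hrU⟩ := nhds_basis_closedBall.mem_iff.1 ((U α).isOpen.mem_nhds hx)
    have hk : (α, x, r / 2) ∈ S := ⟨half_pos hr, by simpa [mul_div_cancel₀] using hrU⟩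
    have hmem : x ∈ ⋃ k : S, ball k.1.2.1 k.1.2.2 :=
      mem_iUnion.2 ⟨⟨_, hk⟩, mem_ball_self (half_pos hr)⟩
    rw [← hTS, mem_iUnion₂] at hmem
    obtain ⟨k, hkT, hxk⟩ := hmem
    exact ⟨k, ⟨k, hkT, rfl⟩, hxk⟩

/-! ### The sheaf axioms -/

theorem eq_of_restrict_eq {ι : Type*} (U : ι → Opens (E N)) (F G : Boehmian (⨆ α, U α))
    (h : ∀ α, restrict (le_iSup U α) F = restrict (le_iSup U α) G) : F = G := by
  obtain ⟨f, rfl⟩ := (null (⨆ α, U α)).mkQ_surjective F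
  obtain ⟨g, rfl⟩ := (null (⨆ α, U α)).mkQ_surjective G
  have hn : ∀ α, IsNull (fun n => restrictFun (le_iSup U α) (f.1 n - g.1 n)) := fun α =>
    (Boehmian.mk_eq_mk_iff (restrictSeq (le_iSup U α) f) (restrictSeq (le_iSup U α) g)).1 (h α)
  refine (Boehmian.mk_eq_mk_iff f g).2 (isNull_of_locally fun x hx => ?_)
  obtain ⟨α, hα⟩ := Opens.mem_iSup.1 hx
  exact ⟨U α, le_iSup U α, hα, hn α⟩

theorem exists_restrict_eq {ι : Type*} (U : ι → Opens (E N)) (F : ∀ α, Boehmian (U α))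
    (hF : ∀ α β, restrict (inf_le_left : U α ⊓ U β ≤ U α) (F α) =
      restrict (inf_le_right : U α ⊓ U β ≤ U β) (F β)) :
    ∃ G : Boehmian (⨆ α, U α), ∀ α, restrict (le_iSup U α) G = F α := by
  choose f hfF using fun α => (null (U α)).mkQ_surjective (F α)
  have hfn : ∀ α β, IsNull (fun n => restrictFun (inf_le_left : U α ⊓ U β ≤ U α) ((f α).1 n) -
      restrictFun (inf_le_right : U α ⊓ U β ≤ U β) ((f β).1 n)) := by
    intro α β
    have h := hF α β
    rw [← hfF α, ← hfF β] at h
    exact (Boehmian.mk_eq_mk_iff (restrictSeq _ (f α)) (restrictSeq _ (f β))).1 h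
  obtain ⟨κ, hκ, hκU, hκc⟩ := exists_countable_ball_cover U
  have := hκ.to_subtype
  obtain ⟨g, hg⟩ := exists_glued_seq (κ := κ) (fun k => (f k.1.1).2) (fun k l => hfn k.1.1 l.1.1)
    (fun k => (hκU k k.2).1) (fun k => (hκU k k.2).2)
  -- A ball meeting `U α` may carry another index `k.1`. On its intersection with `U α`, `g - f_α`
  -- is the sum of `g - f_{k.1}` (null by construction) and `f_{k.1} - f_α` (null by compatibility).
  have hgf : ∀ α, IsNull (fun n => (g n).restrict (U α : Set (E N)) - (f α).1 n) := by
    refine fun α => isNull_of_locally fun x hx => ?_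
    obtain ⟨k, hk, hxk⟩ := hκc α x hx
    let B : Opens (E N) := ⟨ball k.2.1 k.2.2, isOpen_ball⟩
    have hB : B ≤ U k.1 := fun y hy => (hκU k hk).2 <|
      closedBall_subset_closedBall (by linarith [(hκU k hk).1]) (ball_subset_closedBall hy)
    have h1 := hg ⟨k, hk⟩ (U α ⊓ B) (inf_le_right.trans hB) fun y hy => hy.2
    have h2 := (hfn k.1 α).restrict (le_inf (inf_le_right.trans hB) inf_le_left : U α ⊓ B ≤ _)
    refine ⟨U α ⊓ B, inf_le_left, ⟨hx, hxk⟩, ?_⟩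
    convert h1.add h2 using 1
    ext n y
    simp [restrictFun]
    rfl
  have hgF : IsFundamental (fun n => (g n).restrict ((⨆ α, U α : Opens (E N)) : Set (E N))) := by
    refine isFundamental_of_locally fun x hx => ?_
    obtain ⟨α, hα⟩ := Opens.mem_iSup.1 hx
    refine ⟨U α, le_iSup U α, hα, ?_⟩
    -- On `U α`, `g = (g - f_α) + f_α` is null plus fundamental.
    convert (hgf α).isFundamental.add (f α).2 using 1
    ext n y
    simp [restrictFun]
    rfl
  refine ⟨Boehmian.mk ⟨_, hgF⟩, fun α => ?_⟩
  rw [restrict_mk, ← hfF α]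
  exact (Boehmian.mk_eq_mk_iff _ _).2 (hgf α)

theorem presheaf_isSheaf (N : ℕ) : (presheaf N).IsSheaf := by
  rw [TopCat.Presheaf.isSheaf_iff_isSheafUniqueGluing]
  intro ι U sf hsf
  -- Sections and their compatibility in the presheaf unfold definitionally to Boehmians with equal
  -- restrictions to the overlaps.
  obtain ⟨G, hG⟩ := exists_restrict_eq U sf hsf
  exact ⟨G, hG, fun G' hG' => eq_of_restrict_eq U G' G fun α => (hG' α).trans (hG α).symm⟩

end Boehmians

/-- The Boehmians over `ℝ^N` form a sheaf (of real vector spaces). The second and third conjuncts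
spell out locality and gluing for arbitrary families of open sets. -/
theorem mainTheorem1 (N : ℕ) :
    (Boehmians.presheaf N).IsSheaf ∧
    (∀ {ι : Type*} (U : ι → TopologicalSpace.Opens (Boehmians.E N))
      (F G : Boehmians.Boehmian (⨆ α, U α)),
      (∀ α, Boehmians.restrict (le_iSup U α) F = Boehmians.restrict (le_iSup U α) G) → F = G) ∧
    (∀ {ι : Type*} (U : ι → TopologicalSpace.Opens (Boehmians.E N))
      (F : ∀ α, Boehmians.Boehmian (U α)),
      (∀ α β, Boehmians.restrict (inf_le_left : U α ⊓ U β ≤ U α) (F α) =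
        Boehmians.restrict (inf_le_right : U α ⊓ U β ≤ U β) (F β)) →
      ∃ G : Boehmians.Boehmian (⨆ α, U α),
        ∀ α, Boehmians.restrict (le_iSup U α) G = F α) :=
  ⟨Boehmians.presheaf_isSheaf N, fun U F G => Boehmians.eq_of_restrict_eq U F G,
    fun U F => Boehmians.exists_restrict_eq U F⟩
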